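/- Let $\Lambda=\mathbb C[p_1,p_2,p_3,\dots]$ and define the Bernstein operators $B_n$ $(n\in\mathbb Z)$ on $\Lambda$ by $$\sum_{n\in\mathbb Z}B_nt^n=\exp\Big(\sum_{k\ge1}\frac{t^k}{k}p_k\Big)\exp\Big(-\sum_{k\ge1}t^{-k}\frac{\partial}{\partial p_k}\Big).$$ A composition of $m$ of length $l$ is a sequence $\mu=(\mu_1,\dots,\mu_l)$ of integers (negative or zero components are allowed) with sum $m$; put $B_\mu=B_{\mu_1}B_{\mu_2}\cdots B_{\mu_l}$. The code of $\mu$ is the doubly infinite word in the letters $R,L,U$ (unit steps right, left, up), taken up to translation of the indices, obtained by walking up the negative $y$-axis to $(0,-l)$; then, for $i=l,l-1,\dots,1$, walking horizontally along $y=-i$ to abscissa $\mu_i$ and making one step up; and finally walking right along the $x$-axis for ever. It contains no consecutive $LR$ or $RL$. An arbitrary doubly infinite word is said to give the code of $\nu$ if it becomes the code of $\nu$ after finitely many cancellations of consecutive $LR$ or $RL$. **Theorem.** Let $\mu$ be a composition of $m$ of length $l$ whose code has the form $$\cdots\beta_3\beta_2\beta_1L^kU\gamma_1\gamma_2\gamma_3\cdots,\qquad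 k\ge1,$$ where every $\beta_i$ is $R$ or $U$, and $\beta_1=U$. 1. If $\beta_k=U$, then $B_\mu=0$, provided that all components of $\mu$ are nonnegative or, more generally, that $\beta_k$ is not one of the steps up the negative $y$-axis ending at $(0,-l)$. 2. If $\beta_k=R$, then there is exactly one composition $\nu$ of length $l$ whose code is given by $$\cdots\beta_{k+1}\,U\,\beta_{k-1}\cdots\beta_2\beta_1L^{k-1}\gamma_1\gamma_2\gamma_3\cdots .$$ This $\nu$ is a composition of $m$, its components are nonnegative if those of $\mu$ are, and $B_\mu=(-1)^jB_\nu$, where $j$ is the number of $U$'s in $\beta_{k-1}\cdots\beta_2\beta_1$. -/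

import Mathlib

noncomputable section

/-! ### Bernstein operators -/

/-- The ring of symmetric functions `Λ = ℂ[p₁, p₂, p₃, …]`; the variable `X k` is the power sum
`p_k`, for `k ≥ 1`. -/
abbrev SymFun : Type := MvPolynomial ℕ+ ℂ

/-- The coefficient of `z ^ m` in `exp A = ∑_j A ^ j / j!`, for a power series `A` in `z` with zero
constant term over a (possibly noncommutative) `ℂ`-algebra; only the `j ≤ m` contribute, because
`A ^ j` is divisible by `z ^ j`. -/
def expCoeff {S : Type} [Ring S] [Algebra ℂ S] (A : PowerSeries S) (m : ℕ) : S :=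
  ∑ j ∈ Finset.range (m + 1), ((j.factorial : ℂ)⁻¹) • PowerSeries.coeff m (A ^ j)

/-- The series `∑_{k ≥ 1} (z ^ k / k) p_k` over `Λ`. -/
def creationSeries : PowerSeries SymFun :=
  PowerSeries.mk fun m =>
    if h : 0 < m then ((m : ℂ)⁻¹) • (MvPolynomial.X (m.toPNat h) : SymFun) else 0

/-- The operator `∂/∂p_k` on `Λ`. -/
def diffOp (k : ℕ+) : Module.End ℂ SymFun :=
  (MvPolynomial.pderiv k : Derivation ℂ SymFun SymFun).toLinearMap

/-- The series `-∑_{k ≥ 1} z ^ k ∂/∂p_k` over the algebra of linear operators on `Λ`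
(here `z` stands for `t⁻¹`). -/
def annihilationSeries : PowerSeries (Module.End ℂ SymFun) :=
  PowerSeries.mk fun m =>
    if h : 0 < m then -diffOp (m.toPNat h) else 0

/-- The coefficient of `t ^ a` in `exp (∑_{k ≥ 1} (t ^ k / k) p_k)`, for `a ∈ ℤ`. -/
def creationCoeff (a : ℤ) : SymFun :=
  if 0 ≤ a then expCoeff creationSeries a.toNat else 0

/-- The coefficient of `t ^ (-b)` in `exp (-∑_{k ≥ 1} t ^ (-k) ∂/∂p_k)`. -/
def annihilationCoeff (b : ℕ) : Module.End ℂ SymFun :=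
  expCoeff annihilationSeries b

/-- All monomials of `f` have degree at most `d`, where `p_k` has degree `k`. -/
def DegLE (f : SymFun) (d : ℤ) : Prop :=
  ∀ s ∈ f.support, ((s.sum fun k e => (k : ℕ) * e : ℕ) : ℤ) ≤ d

theorem degLE_zero (d : ℤ) : DegLE 0 d := by
  intro s hs
  simp at hs

theorem DegLE.add {f g : SymFun} {d : ℤ} (hf : DegLE f d) (hg : DegLE g d) :
    DegLE (f + g) d := by
  classical
  intro s hs
  rcases Finset.mem_union.1 (MvPolynomial.support_add hs) with h | h
  · exact hf s h
  · exact hg s h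

theorem DegLE.neg {f : SymFun} {d : ℤ} (hf : DegLE f d) : DegLE (-f) d := by
  intro s hs
  exact hf s (by simpa using hs)

theorem DegLE.sum {ι : Type} {t : Finset ι} {f : ι → SymFun} {d : ℤ}
    (h : ∀ i ∈ t, DegLE (f i) d) : DegLE (∑ i ∈ t, f i) d := by
  classical
  induction t using Finset.induction_on with
  | empty => simpa using degLE_zero d
  | insert a t ha ih =>
    rw [Finset.sum_insert ha]
    exact (h a (by simp)).add (ih fun i hi => h i (by simp [hi]))

theorem DegLE.eq_zero {f : SymFun} {d : ℤ} (hf : DegLE f d) (hd : d < 0) : f = 0 := by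
  by_contra hne
  obtain ⟨s, hs⟩ := Finset.nonempty_iff_ne_empty.2
    (fun h => hne (MvPolynomial.support_eq_empty.1 h))
  have := hf s hs
  omega

theorem exists_degLE (f : SymFun) : ∃ d : ℕ, DegLE f d := by
  refine ⟨f.support.sup fun s => s.sum fun k e => (k : ℕ) * e, fun s hs => ?_⟩
  exact_mod_cast Finset.le_sup (f := fun s : ℕ+ →₀ ℕ => s.sum fun k e => (k : ℕ) * e) hs

theorem DegLE.pderiv {f : SymFun} {d : ℤ} (hf : DegLE f d) (k : ℕ+) :
    DegLE (MvPolynomial.pderiv k f) (d - (k : ℕ)) := by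
  classical
  intro s hs
  have h1 : s + Finsupp.single k 1 ∈ f.support := by
    rw [MvPolynomial.mem_support_iff] at hs ⊢
    intro h0
    exact hs (by rw [MvPolynomial.coeff_pderiv, h0]; simp)
  have h2 := hf _ h1
  rw [Finsupp.sum_add_index' (by simp) (by intros; ring)] at h2
  rw [Finsupp.sum_single_index (by simp)] at h2
  push_cast at h2 ⊢
  omega

theorem degLE_coeff_annihilationSeries {f : SymFun} {d : ℤ} (hf : DegLE f d) (m : ℕ) :
    DegLE (PowerSeries.coeff m annihilationSeries f) (d - m) := by
  rw [annihilationSeries, PowerSeries.coeff_mk]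
  by_cases h : 0 < m
  · rw [dif_pos h]
    exact (hf.pderiv (m.toPNat h)).neg
  · rw [dif_neg h]
    exact degLE_zero _

theorem degLE_coeff_annihilationSeries_pow (j : ℕ) :
    ∀ (m : ℕ) {f : SymFun} {d : ℤ}, DegLE f d →
      DegLE (PowerSeries.coeff m (annihilationSeries ^ j) f) (d - m) := by
  induction j with
  | zero =>
    intro m f d hf
    rw [pow_zero, PowerSeries.coeff_one]
    split_ifs with h
    · subst h
      simpa using hf
    · exact degLE_zero _
  | succ j ih =>
    intro m f d hf
    rw [pow_succ, PowerSeries.coeff_mul, LinearMap.sum_apply]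
    refine DegLE.sum fun x hx => ?_
    have hx' : x.1 + x.2 = m := by simpa using hx
    have := ih x.1 (degLE_coeff_annihilationSeries hf x.2)
    rw [Module.End.mul_apply]
    have e : d - (m : ℤ) = d - x.2 - x.1 := by rw [← hx']; push_cast; ring
    rw [e]
    exact this

/-- Only finitely many coefficients of the second exponential act nontrivially on a given `f`. -/
theorem annihilationCoeff_finite (f : SymFun) :
    {b : ℕ | annihilationCoeff b f ≠ 0}.Finite := by
  obtain ⟨d, hd⟩ := exists_degLE f
  refine (Set.finite_Iic d).subset fun b hb => ?_
  by_contra hlt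
  apply hb
  have hlt' : d < b := by simpa using hlt
  rw [annihilationCoeff, expCoeff, LinearMap.sum_apply]
  refine Finset.sum_eq_zero fun j _ => ?_
  rw [LinearMap.smul_apply,
    (degLE_coeff_annihilationSeries_pow j b hd).eq_zero (by omega), smul_zero]

theorem bernstein_support_finite (n : ℤ) (f : SymFun) :
    (Function.support fun b : ℕ => creationCoeff (n + b) * annihilationCoeff b f).Finite :=
  (annihilationCoeff_finite f).subset fun b hb h0 => hb (by
    change creationCoeff (n + b) * annihilationCoeff b f = 0
    rw [h0, mul_zero])

/-- The Bernstein operator `B_n` on `Λ`: the coefficient of `t ^ n` in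
`exp (∑_{k ≥ 1} (t ^ k / k) p_k) exp (-∑_{k ≥ 1} t ^ (-k) ∂/∂p_k)`. The sum over `b` is finite on
every `f` by `bernstein_support_finite`. -/
def bernsteinOp (n : ℤ) : Module.End ℂ SymFun where
  toFun f := ∑ᶠ b : ℕ, creationCoeff (n + b) * annihilationCoeff b f
  map_add' f g := by
    rw [← finsum_add_distrib (bernstein_support_finite n f) (bernstein_support_finite n g)]
    exact finsum_congr fun b => by rw [map_add, mul_add]
  map_smul' c f := by
    rw [RingHom.id_apply, smul_finsum' c (bernstein_support_finite n f)]
    exact finsum_congr fun b => by rw [map_smul, mul_smul_comm]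

/-- `B_μ = B_{μ₁} B_{μ₂} ⋯ B_{μ_l}` (composition of operators) for `μ = (μ₁, …, μ_l)`. -/
def bernsteinComp (μ : List ℤ) : Module.End ℂ SymFun :=
  (μ.map bernsteinOp).prod

/-! ### Codes -/

/-- Unit steps: right, left, up. -/
inductive Letter : Type
  | R
  | L
  | U
  deriving DecidableEq

/-- The doubly infinite word `… β₃ β₂ β₁ w γ₁ γ₂ γ₃ …`, indexed by `ℤ` in such a way that the
finite word `w` starts at position `0`. Here `β i` is `β_{i+1}`, so `β_i` is at position `-i`, and
`γ i` is `γ_{i+1}`. -/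
def biWord (β : ℕ → Letter) (w : List Letter) (γ : ℕ → Letter) : ℤ → Letter
  | Int.ofNat n => if h : n < w.length then w[n] else γ (n - w.length)
  | Int.negSucc n => β n

/-- The horizontal steps from abscissa `a` to abscissa `b`. -/
def hSteps (a b : ℤ) : List Letter :=
  List.replicate (b - a).toNat Letter.R ++ List.replicate (a - b).toNat Letter.L

/-- The part of the code of `μ = (μ₁, …, μ_l)` that runs along the rows of its diagram, from the
point `(0, -l)` to the point `(μ₁, 0)`: for each row, from the bottom row `μ_l` to the top row `μ₁`,
horizontal steps to the right end of the row and one step up. -/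
def rowWord : List ℤ → List Letter
  | [] => []
  | a :: rest => rowWord rest ++ hSteps (rest.headD 0) a ++ [Letter.U]

/-- The code of `μ`: up along the negative `y`-axis (the positions `< 0`), along the rows of the
diagram, and then right along the `x`-axis. It contains no consecutive `LR` or `RL`. -/
def code (μ : List ℤ) : ℤ → Letter :=
  biWord (fun _ => Letter.U) (rowWord μ) (fun _ => Letter.R)

/-- Two `ℤ`-indexed sequences are the same doubly infinite word: they differ by a translation. -/
def SameWord (v w : ℤ → Letter) : Prop :=
  ∃ s : ℤ, ∀ n : ℤ, w (n + s) = v n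

/-- `w` arises from `v` by deleting one consecutive pair `LR` or `RL`. -/
def CancelStep (v w : ℤ → Letter) : Prop :=
  ∃ (β γ : ℕ → Letter) (x : List Letter),
    (x = [Letter.L, Letter.R] ∨ x = [Letter.R, Letter.L]) ∧
      SameWord v (biWord β x γ) ∧ SameWord w (biWord β [] γ)

/-- `w` arises from `v` by finitely many (possibly zero) cancellations of consecutive `LR` or `RL`,
as doubly infinite words. -/
def ReducesTo (v w : ℤ → Letter) : Prop :=
  Relation.ReflTransGen (fun v w => SameWord v w ∨ CancelStep v w) v w

end

noncomputable section

/-! ### Exponentials of power series -/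

section ExpCoeff

variable {S : Type} [Ring S]

/-! Everything rests on the exchange relation `B_m B_n = -B_{n-1} B_{m+1}` (`bernsteinOp_mul`),
whose case `n = m + 1` gives `B_m B_{m+1} = 0`. Write `h_a` for `creationCoeff a` and `E_b` for
`annihilationCoeff b`. From `E_b h_a = h_a E_b - h_{a-1} E_{b-1}` one gets `B_m B_n = N(m,n) -
N(m+1,n-1)` with a symmetric normally ordered product `N`; swapping the arguments of `N` gives the
relation.

Iterating it, `B_a` passes the `r` operators of a list of rows: each of those rows drops by one and
`a` grows to `a + r`, with sign `(-1)^r` (`bernsteinOp_mul_bernsteinComp_map`).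

Cut the code as `A β_k B L^k U C`, with `B = β_{k-1} ⋯ β_1`. The row of the displayed `U` ends at
the abscissa after `A β_k`, plus `(k - 1) - r`, minus `k`, where `r` is the number of `U`'s in `B`.
After passing the `r` rows of `B` it is one less than the abscissa after `A β_k`. If `β_k = U`, it
meets the row of `β_k`, which is longer by one, and the product vanishes. If `β_k = R`, the result
is exactly the list of rows read off after turning `β_k` into `U` and deleting one `L` and the old
`U`.

For the statement about words, every word involved is a finite word between `⋯UUU` and `RRR⋯`. The
abscissas of its up steps (`rows`), padded by zeros, are invariant under translation and
cancellation, so `ν` is determined by its length (`eq_rows_of_reducesTo`). Conversely, cancelling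
while reading from left to right reaches the code of `rows w` (`reducesTo_code_rows`). -/

theorem coeff_pow_eq_zero_of_lt {A : PowerSeries S} (hA : PowerSeries.coeff 0 A = 0) (j : ℕ) :
    ∀ m : ℕ, m < j → PowerSeries.coeff m (A ^ j) = 0 := by
  induction j with
  | zero => intro m hm; omega
  | succ j ih =>
    intro m hm
    rw [pow_succ, PowerSeries.coeff_mul]
    refine Finset.sum_eq_zero fun x hx => ?_
    have hx' : x.1 + x.2 = m := by simpa using hx
    rcases Nat.eq_zero_or_pos x.2 with h | h
    · rw [h, hA, mul_zero]
    · rw [ih x.1 (by omega), zero_mul]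

variable [Algebra ℂ S]

theorem expCoeff_eq_sum_range {A : PowerSeries S} (hA : PowerSeries.coeff 0 A = 0) {m N : ℕ}
    (hN : m < N) :
    expCoeff A m =
      ∑ j ∈ Finset.range N, ((j.factorial : ℂ)⁻¹) • PowerSeries.coeff m (A ^ j) := by
  refine Finset.sum_subset (by simpa using hN) fun j _ hj => ?_
  rw [coeff_pow_eq_zero_of_lt hA j m (by simpa using hj), smul_zero]

theorem expCoeff_zero (A : PowerSeries S) : expCoeff A 0 = 1 := by
  simp [expCoeff]

theorem commute_expCoeff {A : PowerSeries S} {x : S}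
    (h : ∀ i, Commute x (PowerSeries.coeff i A)) (m : ℕ) : Commute x (expCoeff A m) := by
  have key : ∀ j m, Commute x (PowerSeries.coeff m (A ^ j)) := by
    intro j
    induction j with
    | zero =>
      intro m
      rw [pow_zero, PowerSeries.coeff_one]
      split_ifs
      · exact Commute.one_right x
      · exact Commute.zero_right x
    | succ j ih =>
      intro m
      rw [pow_succ, PowerSeries.coeff_mul]
      exact Commute.sum_right _ _ _ fun y _ => (ih y.1).mul_right (h y.2)
  exact Commute.sum_right _ _ _ fun j _ => (key j m).smul_right _

/-- The Euler operator `z d/dz` on power series. -/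
def eulerOp (A : PowerSeries S) : PowerSeries S :=
  PowerSeries.mk fun m => (m : ℂ) • PowerSeries.coeff m A

theorem coeff_eulerOp (A : PowerSeries S) (m : ℕ) :
    PowerSeries.coeff m (eulerOp A) = (m : ℂ) • PowerSeries.coeff m A :=
  PowerSeries.coeff_mk _ _

theorem eulerOp_mul (A B : PowerSeries S) :
    eulerOp (A * B) = eulerOp A * B + A * eulerOp B := by
  ext m
  rw [coeff_eulerOp, map_add, PowerSeries.coeff_mul, PowerSeries.coeff_mul, PowerSeries.coeff_mul,
    Finset.smul_sum, ← Finset.sum_add_distrib]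
  refine Finset.sum_congr rfl fun x hx => ?_
  have hx' : x.1 + x.2 = m := by simpa using hx
  rw [coeff_eulerOp, coeff_eulerOp, smul_mul_assoc, mul_smul_comm, ← add_smul, ← hx',
    Nat.cast_add]

/-- In a noncommutative ring the power rule for `A ^ j` needs `A` to commute with its derivative;
commuting coefficients suffice. -/
theorem commute_eulerOp {A : PowerSeries S}
    (hA : ∀ i j, Commute (PowerSeries.coeff i A) (PowerSeries.coeff j A)) :
    Commute (eulerOp A) A := by
  ext m
  rw [PowerSeries.coeff_mul, PowerSeries.coeff_mul,
    ← Finset.sum_equiv (Equiv.prodComm ℕ ℕ) (s := Finset.HasAntidiagonal.antidiagonal m)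
      (t := Finset.HasAntidiagonal.antidiagonal m)
      (f := fun x => PowerSeries.coeff x.2 (eulerOp A) * PowerSeries.coeff x.1 A)
      (by intro x; simp [add_comm]) (by intro x _; rfl)]
  refine Finset.sum_congr rfl fun x _ => ?_
  rw [coeff_eulerOp, smul_mul_assoc, mul_smul_comm, (hA x.1 x.2).eq]

theorem eulerOp_pow_succ {A : PowerSeries S}
    (hA : ∀ i j, Commute (PowerSeries.coeff i A) (PowerSeries.coeff j A)) (j : ℕ) :
    eulerOp (A ^ (j + 1)) = (j + 1) • (eulerOp A * A ^ j) := by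
  induction j with
  | zero => simp
  | succ j ih =>
    rw [pow_succ, eulerOp_mul, ih, ← ((commute_eulerOp hA).pow_right (j + 1)).eq, smul_mul_assoc,
      mul_assoc, ← pow_succ, ← succ_nsmul]

/-- The recursion `m e_m = ∑_{k + i = m} k A_k e_i` for the coefficients `e_m` of `exp A`. -/
theorem smul_expCoeff {A : PowerSeries S} (hA0 : PowerSeries.coeff 0 A = 0)
    (hA : ∀ i j, Commute (PowerSeries.coeff i A) (PowerSeries.coeff j A)) (m : ℕ) :
    (m : ℂ) • expCoeff A m =
      ∑ x ∈ Finset.HasAntidiagonal.antidiagonal m, ((x.1 : ℂ) • PowerSeries.coeff x.1 A) * expCoeff A x.2 := by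
  have h1 : ∀ j, (m : ℂ) • (((j + 1).factorial : ℂ)⁻¹ • PowerSeries.coeff m (A ^ (j + 1))) =
      ∑ x ∈ Finset.HasAntidiagonal.antidiagonal m, ((x.1 : ℂ) • PowerSeries.coeff x.1 A) *
        ((j.factorial : ℂ)⁻¹ • PowerSeries.coeff x.2 (A ^ j)) := by
    intro j
    rw [smul_comm, ← coeff_eulerOp, eulerOp_pow_succ hA, ← Nat.cast_smul_eq_nsmul ℂ,
      PowerSeries.coeff_smul, smul_smul, PowerSeries.coeff_mul, Finset.smul_sum]
    refine Finset.sum_congr rfl fun x _ => ?_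
    rw [coeff_eulerOp, mul_smul_comm]
    congr 1
    rw [Nat.factorial_succ, Nat.cast_mul]
    have : ((j + 1 : ℕ) : ℂ) ≠ 0 := Nat.cast_ne_zero.2 (Nat.succ_ne_zero j)
    field_simp
  -- After the term `j = 0` is split off, the indices `j + 1` run over a full range `j < m + 1`,
  -- long enough for every `expCoeff A x.2` with `x.2 ≤ m`.
  rw [expCoeff_eq_sum_range hA0 (N := m + 2) (by omega), Finset.sum_range_succ', smul_add,
    Finset.smul_sum, Finset.sum_congr rfl fun j _ => h1 j, Finset.sum_comm]
  have h0 : (m : ℂ) • (((Nat.factorial 0 : ℕ) : ℂ)⁻¹ • PowerSeries.coeff m (A ^ 0)) = 0 := by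
    rw [pow_zero, PowerSeries.coeff_one]
    split_ifs with h
    · simp [h]
    · simp
  rw [h0, add_zero]
  refine Finset.sum_congr rfl fun x hx => ?_
  have hx' : x.1 + x.2 = m := by simpa using hx
  rw [← Finset.mul_sum, ← expCoeff_eq_sum_range hA0 (by omega)]

end ExpCoeff

/-! ### The commutation relation of Bernstein operators -/

theorem coeff_zero_creationSeries : PowerSeries.coeff 0 creationSeries = 0 := by
  simp [creationSeries]

theorem coeff_zero_annihilationSeries : PowerSeries.coeff 0 annihilationSeries = 0 := by
  simp [annihilationSeries]

theorem coeff_creationSeries (k : ℕ+) :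
    PowerSeries.coeff (k : ℕ) creationSeries = ((k : ℕ) : ℂ)⁻¹ • (MvPolynomial.X k : SymFun) := by
  rw [creationSeries, PowerSeries.coeff_mk, dif_pos k.pos]
  rfl

theorem coeff_annihilationSeries (k : ℕ+) :
    PowerSeries.coeff (k : ℕ) annihilationSeries = -diffOp k := by
  rw [annihilationSeries, PowerSeries.coeff_mk, dif_pos k.pos]
  rfl

theorem diffOp_mul (k : ℕ+) (f g : SymFun) :
    diffOp k (f * g) = f * diffOp k g + diffOp k f * g := by
  have := (MvPolynomial.pderiv k : Derivation ℂ SymFun SymFun).leibniz f g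
  rw [smul_eq_mul, smul_eq_mul, mul_comm g] at this
  exact this

theorem commute_diffOp (i j : ℕ+) : Commute (diffOp i) (diffOp j) := by
  have h : ⁅(MvPolynomial.pderiv i : Derivation ℂ SymFun SymFun),
      (MvPolynomial.pderiv j : Derivation ℂ SymFun SymFun)⁆ = 0 := by
    apply MvPolynomial.derivation_ext
    intro k
    rw [Derivation.commutator_apply, MvPolynomial.pderiv_X, MvPolynomial.pderiv_X]
    classical
    simp only [Pi.single_apply]
    split_ifs <;> simp
  refine LinearMap.ext fun f => ?_
  have := congrArg (fun D : Derivation ℂ SymFun SymFun => D f) h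
  simp only [Derivation.commutator_apply, Derivation.coe_zero, Pi.zero_apply] at this
  exact sub_eq_zero.1 this

theorem commute_coeff_annihilationSeries (i j : ℕ) :
    Commute (PowerSeries.coeff i annihilationSeries) (PowerSeries.coeff j annihilationSeries) := by
  rcases Nat.eq_zero_or_pos i with rfl | hi
  · rw [coeff_zero_annihilationSeries]
    exact Commute.zero_left _
  rcases Nat.eq_zero_or_pos j with rfl | hj
  · rw [coeff_zero_annihilationSeries]
    exact Commute.zero_right _
  have h1 := coeff_annihilationSeries ⟨i, hi⟩
  have h2 := coeff_annihilationSeries ⟨j, hj⟩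
  rw [PNat.mk_coe] at h1 h2
  rw [h1, h2]
  exact ((commute_diffOp _ _).neg_left).neg_right

theorem commute_annihilationCoeff (b c : ℕ) :
    Commute (annihilationCoeff b) (annihilationCoeff c) :=
  commute_expCoeff (fun i =>
    (commute_expCoeff (fun j => commute_coeff_annihilationSeries i j) b).symm) c

/-! ### Exchange relation between multiplication by `h_a` and the operators `E_b` -/

theorem creationCoeff_of_neg {a : ℤ} (h : a < 0) : creationCoeff a = 0 :=
  if_neg (by omega)

theorem creationCoeff_natCast (a : ℕ) :
    creationCoeff (a : ℤ) = expCoeff creationSeries a := by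
  rw [creationCoeff, if_pos (by omega), Int.toNat_natCast]

/-- `a h_a = ∑_{k=1}^a p_k h_{a-k}`. -/
theorem smul_creationCoeff (a : ℕ) :
    (a : ℂ) • creationCoeff a =
      ∑ i ∈ Finset.range a, MvPolynomial.X i.succPNat * creationCoeff ((a : ℤ) - (i + 1 : ℕ)) := by
  rw [creationCoeff_natCast, smul_expCoeff coeff_zero_creationSeries (fun _ _ => Commute.all _ _),
    Finset.Nat.sum_antidiagonal_eq_sum_range_succ_mk, Finset.sum_range_succ']
  simp only [Nat.cast_zero, zero_smul, zero_mul, add_zero]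
  refine Finset.sum_congr rfl fun i hi => ?_
  have hi' : i < a := by simpa using hi
  have := coeff_creationSeries i.succPNat
  rw [Nat.succPNat_coe, Nat.succ_eq_add_one] at this
  rw [this, smul_smul, mul_inv_cancel₀ (Nat.cast_ne_zero.2 (Nat.succ_ne_zero i)), one_smul,
    ← Nat.cast_sub (by omega), creationCoeff_natCast]

/-- `b E_b = -∑_{k=1}^b k ∂/∂p_k E_{b-k}`. -/
theorem smul_annihilationCoeff (b : ℕ) (f : SymFun) :
    (b : ℂ) • annihilationCoeff b f =
      ∑ i ∈ Finset.range b,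
        -(((i + 1 : ℕ) : ℂ) • diffOp i.succPNat (annihilationCoeff (b - (i + 1)) f)) := by
  have h := smul_expCoeff coeff_zero_annihilationSeries commute_coeff_annihilationSeries b
  rw [Finset.Nat.sum_antidiagonal_eq_sum_range_succ_mk, Finset.sum_range_succ'] at h
  simp only [Nat.cast_zero, zero_smul, zero_mul, add_zero] at h
  have h' := congrArg (fun T : Module.End ℂ SymFun => T f) h
  simp only [LinearMap.smul_apply, LinearMap.sum_apply] at h'
  rw [annihilationCoeff, h']
  refine Finset.sum_congr rfl fun i hi => ?_
  have := coeff_annihilationSeries i.succPNat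
  rw [Nat.succPNat_coe, Nat.succ_eq_add_one] at this
  rw [this]
  exact smul_neg ((i + 1 : ℕ) : ℂ) (diffOp i.succPNat (annihilationCoeff (b - (i + 1)) f))

theorem diffOp_X (k i : ℕ+) : diffOp k (MvPolynomial.X i : SymFun) = if i = k then 1 else 0 := by
  classical
  have := MvPolynomial.pderiv_X (R := ℂ) k i
  rw [Pi.single_apply] at this
  refine Eq.trans this ?_
  simp [eq_comm]

/-- `∂h_a/∂p_k = h_{a-k} / k`. -/
theorem smul_diffOp_creationCoeff (k : ℕ+) (a : ℤ) :
    ((k : ℕ) : ℂ) • diffOp k (creationCoeff a) = creationCoeff (a - (k : ℕ)) := by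
  have hk := k.pos
  rcases lt_or_ge a 0 with ha | ha
  · rw [creationCoeff_of_neg ha, creationCoeff_of_neg (by omega), map_zero, smul_zero]
  lift a to ℕ using ha
  induction a using Nat.strong_induction_on with
  | _ a ih =>
  rcases Nat.eq_zero_or_pos a with rfl | ha
  · rw [creationCoeff_natCast, expCoeff_zero, creationCoeff_of_neg (by push_cast; omega)]
    have : diffOp k (1 : SymFun) = 0 :=
      (MvPolynomial.pderiv k : Derivation ℂ SymFun SymFun).map_one_eq_zero
    rw [this, smul_zero]
  have ha0 : (a : ℂ) ≠ 0 := Nat.cast_ne_zero.2 ha.ne'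
  apply smul_right_injective _ ha0
  change (a : ℂ) • _ = (a : ℂ) • _
  rw [smul_comm, ← map_smul, smul_creationCoeff, map_sum, Finset.smul_sum]
  -- In `k ∂/∂p_k` of `∑ p_i h_{a-i}`, the derivatives of the `h_{a-i}` add up to `(a - k) h_{a-k}`
  -- and the derivative of `p_k` adds `k h_{a-k}`.
  have step : ∀ i ∈ Finset.range a,
      ((k : ℕ) : ℂ) • diffOp k (MvPolynomial.X i.succPNat *
        creationCoeff ((a : ℤ) - (i + 1 : ℕ))) =
      MvPolynomial.X i.succPNat * creationCoeff ((a : ℤ) - (k : ℕ) - (i + 1 : ℕ)) +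
        if i = (k : ℕ) - 1 then ((k : ℕ) : ℂ) • creationCoeff ((a : ℤ) - (k : ℕ)) else 0 := by
    intro i hi
    have hi' : i < a := by simpa using hi
    have h1 := ih (a - (i + 1)) (by omega)
    rw [Nat.cast_sub (by omega)] at h1
    rw [diffOp_mul, smul_add, ← mul_smul_comm, h1, diffOp_X, sub_right_comm]
    congr 1
    by_cases h : i = (k : ℕ) - 1
    · have e : i.succPNat = k := PNat.eq (by rw [Nat.succPNat_coe]; omega)
      rw [if_pos e, if_pos h, one_mul]
      congr 3
      omega
    · have e : i.succPNat ≠ k := fun e => h (by rw [← e, Nat.succPNat_coe]; omega)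
      rw [if_neg e, if_neg h, zero_mul, smul_zero]
  rw [Finset.sum_congr rfl step, Finset.sum_add_distrib, Finset.sum_ite_eq' (Finset.range a)]
  rcases lt_or_ge a k with hak | hak
  · rw [if_neg (by simp; omega), creationCoeff_of_neg (a := (a : ℤ) - (k : ℕ)) (by omega),
      Finset.sum_eq_zero fun i _ => by rw [creationCoeff_of_neg (by omega), mul_zero]]
    simp
  · rw [if_pos (by simp; omega), ← Nat.cast_sub hak,
      ← Finset.sum_subset (Finset.range_mono (Nat.sub_le a k)) fun i _ hi => by
        rw [creationCoeff_of_neg (by simp at hi; omega), mul_zero],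
      ← smul_creationCoeff, ← add_smul, Nat.cast_sub hak, sub_add_cancel]

/-- `E_{b-1}`, read as `0` for `b = 0`. -/
def annihilationPred (b : ℕ) : Module.End ℂ SymFun :=
  if b = 0 then 0 else annihilationCoeff (b - 1)

theorem annihilationPred_succ (b : ℕ) : annihilationPred (b + 1) = annihilationCoeff b := by
  simp [annihilationPred]

/-- The recursion for `E_b` with the index lowered by one; the factor becomes `b - 1`, and the extra
last summand vanishes because `E_{-1}` is read as `0`. -/
theorem smul_annihilationPred (b : ℕ) (f : SymFun) :
    ((b : ℂ) - 1) • annihilationPred b f =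
      ∑ i ∈ Finset.range b,
        -(((i + 1 : ℕ) : ℂ) • diffOp i.succPNat (annihilationPred (b - (i + 1)) f)) := by
  cases b with
  | zero => simp [annihilationPred]
  | succ b =>
    rw [Finset.sum_range_succ, annihilationPred_succ, Nat.sub_self, Nat.cast_succ,
      add_sub_cancel_right, smul_annihilationCoeff]
    have : annihilationPred 0 f = 0 := by simp [annihilationPred]
    rw [this, map_zero, smul_zero, neg_zero, add_zero]
    refine Finset.sum_congr rfl fun i hi => ?_
    have hi' : i < b := by simpa using hi
    rw [Nat.sub_add_comm (by omega), annihilationPred_succ]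

/-- `E_b h_a = h_a E_b - h_{a-1} E_{b-1}`. -/
theorem annihilationCoeff_creationCoeff_mul (b : ℕ) (a : ℤ) (g : SymFun) :
    annihilationCoeff b (creationCoeff a * g) =
      creationCoeff a * annihilationCoeff b g - creationCoeff (a - 1) * annihilationPred b g := by
  induction b using Nat.strong_induction_on with
  | _ b ih =>
  rcases Nat.eq_zero_or_pos b with rfl | hb
  · simp [annihilationPred, annihilationCoeff, expCoeff_zero]
  have hb0 : (b : ℂ) ≠ 0 := Nat.cast_ne_zero.2 hb.ne'
  apply smul_right_injective _ hb0
  change (b : ℂ) • _ = (b : ℂ) • _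
  -- Leibniz splits each summand of the recursion for `b E_b`: the parts differentiating `g`
  -- reproduce the two recursions for `E_b` and `E_{b-1}`, and the parts differentiating `h_a` and
  -- `h_{a-1}` telescope.
  have step : ∀ i ∈ Finset.range b,
      -(((i + 1 : ℕ) : ℂ) • diffOp i.succPNat
        (annihilationCoeff (b - (i + 1)) (creationCoeff a * g))) =
      creationCoeff a *
          -(((i + 1 : ℕ) : ℂ) • diffOp i.succPNat (annihilationCoeff (b - (i + 1)) g)) -
        creationCoeff (a - 1) *
          -(((i + 1 : ℕ) : ℂ) • diffOp i.succPNat (annihilationPred (b - (i + 1)) g)) +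
        (creationCoeff (a - 1 - (i + 1 : ℕ)) * annihilationPred (b - (i + 1)) g -
          creationCoeff (a - 1 - i) * annihilationPred (b - i) g) := by
    intro i hi
    have hi' : i < b := by simpa using hi
    have h1 := smul_diffOp_creationCoeff i.succPNat a
    have h2 := smul_diffOp_creationCoeff i.succPNat (a - 1)
    rw [Nat.succPNat_coe, Nat.succ_eq_add_one] at h1 h2
    have h3 : annihilationPred (b - i) = annihilationCoeff (b - (i + 1)) := by
      rw [show b - i = b - (i + 1) + 1 by omega, annihilationPred_succ]
    have h4 : a - ((i + 1 : ℕ) : ℤ) = a - 1 - i := by push_cast; ring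
    rw [ih _ (by omega), map_sub, diffOp_mul, diffOp_mul, smul_sub, smul_add, smul_add,
      ← smul_mul_assoc _ (diffOp i.succPNat (creationCoeff a)),
      ← smul_mul_assoc _ (diffOp i.succPNat (creationCoeff (a - 1))), h1, h2, h3, h4, mul_neg, mul_neg, mul_smul_comm,
      mul_smul_comm]
    abel
  -- The telescoping sum leaves `-h_{a-1} E_{b-1} g`, which raises the factor `b - 1` of that term
  -- to `b`.
  have tel := Finset.sum_range_sub
    (fun i : ℕ => creationCoeff (a - 1 - i) * annihilationPred (b - i) g) b
  have h0 : annihilationPred 0 g = 0 := by simp [annihilationPred]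
  simp only [Nat.sub_self, h0, mul_zero, Nat.cast_zero, sub_zero, Nat.sub_zero, zero_sub] at tel
  rw [smul_annihilationCoeff, Finset.sum_congr rfl step, Finset.sum_add_distrib, tel,
    Finset.sum_sub_distrib, ← Finset.mul_sum, ← Finset.mul_sum, ← smul_annihilationCoeff,
    ← smul_annihilationPred, sub_smul, one_smul, mul_sub, smul_sub, mul_smul_comm, mul_smul_comm]
  abel

/-! ### Products of Bernstein operators -/

theorem bernsteinOp_eq_sum_range (n : ℤ) (f : SymFun) (N : ℕ)
    (hN : ∀ b, N ≤ b → annihilationCoeff b f = 0) :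
    bernsteinOp n f =
      ∑ b ∈ Finset.range N, creationCoeff (n + b) * annihilationCoeff b f := by
  change ∑ᶠ b : ℕ, creationCoeff (n + b) * annihilationCoeff b f = _
  refine finsum_eq_sum_of_support_subset _ fun b hb => ?_
  by_contra h
  exact hb (by
    change creationCoeff (n + b) * annihilationCoeff b f = 0
    rw [hN b (by simpa using h), mul_zero])

/-- The normally ordered product of `B_m` and `B_n`, truncated at `N`. -/
def normalOrdered (N : ℕ) (f : SymFun) (m n : ℤ) : SymFun :=
  ∑ c ∈ Finset.range N, ∑ b ∈ Finset.range N,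
    creationCoeff (m + b) * (creationCoeff (n + c) * annihilationCoeff b (annihilationCoeff c f))

theorem annihilationCoeff_comm (b c : ℕ) (f : SymFun) :
    annihilationCoeff b (annihilationCoeff c f) = annihilationCoeff c (annihilationCoeff b f) :=
  congrArg (fun T : Module.End ℂ SymFun => T f) (commute_annihilationCoeff b c).eq

theorem normalOrdered_comm (N : ℕ) (f : SymFun) (m n : ℤ) :
    normalOrdered N f m n = normalOrdered N f n m := by
  rw [normalOrdered, Finset.sum_comm]
  refine Finset.sum_congr rfl fun b _ => Finset.sum_congr rfl fun c _ => ?_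
  rw [annihilationCoeff_comm, mul_left_comm]

/-- Moving `E_b` to the right past `h_{n+c}` leaves the normally ordered product and a correction
with `h_{n+c-1} E_{b-1}`; replacing `b` by `b + 1` there raises `m` and lowers `n`. -/
theorem bernsteinOp_bernsteinOp (m n : ℤ) (f : SymFun) (N : ℕ)
    (hN : ∀ b, N ≤ b → annihilationCoeff b f = 0) :
    bernsteinOp m (bernsteinOp n f) =
      normalOrdered N f m n - normalOrdered N f (m + 1) (n - 1) := by
  rw [bernsteinOp_eq_sum_range n f N hN, map_sum, normalOrdered, normalOrdered,
    ← Finset.sum_sub_distrib]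
  refine Finset.sum_congr rfl fun c _ => ?_
  have hE : ∀ b, N ≤ b → annihilationCoeff b (annihilationCoeff c f) = 0 := fun b hb => by
    rw [annihilationCoeff_comm, hN b hb, map_zero]
  have hc : ∀ b, annihilationCoeff b (creationCoeff (n + c) * annihilationCoeff c f) =
      creationCoeff (n + c) * annihilationCoeff b (annihilationCoeff c f) -
        creationCoeff (n + c - 1) * annihilationPred b (annihilationCoeff c f) :=
    fun b => annihilationCoeff_creationCoeff_mul b _ _
  -- The bound grows by one because of the term with `E_{b-1}`.
  have hM : ∀ b, N + 1 ≤ b →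
      annihilationCoeff b (creationCoeff (n + c) * annihilationCoeff c f) = 0 := by
    intro b hb
    obtain ⟨b, rfl⟩ : ∃ b', b = b' + 1 := ⟨b - 1, by omega⟩
    rw [hc, annihilationPred_succ, hE _ (by omega), hE _ (by omega), mul_zero, mul_zero, sub_zero]
  have h0 : annihilationPred 0 (annihilationCoeff c f) = 0 := by simp [annihilationPred]
  have h1 : ∑ b ∈ Finset.range (N + 1), creationCoeff (m + b) *
      (creationCoeff (n + c) * annihilationCoeff b (annihilationCoeff c f)) =
      ∑ b ∈ Finset.range N, creationCoeff (m + b) *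
      (creationCoeff (n + c) * annihilationCoeff b (annihilationCoeff c f)) := by
    rw [Finset.sum_range_succ, hE N le_rfl, mul_zero, mul_zero, add_zero]
  have h2 : ∑ b ∈ Finset.range (N + 1), creationCoeff (m + b) *
      (creationCoeff (n + c - 1) * annihilationPred b (annihilationCoeff c f)) =
      ∑ b ∈ Finset.range N, creationCoeff (m + 1 + b) *
      (creationCoeff (n - 1 + c) * annihilationCoeff b (annihilationCoeff c f)) := by
    rw [Finset.sum_range_succ', h0, mul_zero, mul_zero, add_zero]
    refine Finset.sum_congr rfl fun b _ => ?_
    rw [annihilationPred_succ, Nat.cast_succ, add_assoc m 1, add_comm (1 : ℤ), add_sub_right_comm]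
  rw [bernsteinOp_eq_sum_range m _ (N + 1) hM, ← h1, ← h2, ← Finset.sum_sub_distrib]
  refine Finset.sum_congr rfl fun b _ => ?_
  rw [hc b, mul_sub]

theorem bernsteinOp_mul (m n : ℤ) :
    bernsteinOp m * bernsteinOp n = -(bernsteinOp (n - 1) * bernsteinOp (m + 1)) := by
  refine LinearMap.ext fun f => ?_
  obtain ⟨M, hM⟩ := (annihilationCoeff_finite f).bddAbove
  have hN : ∀ b, M + 1 ≤ b → annihilationCoeff b f = 0 := fun b hb => by
    by_contra h
    have := hM h
    omega
  rw [LinearMap.neg_apply, Module.End.mul_apply, Module.End.mul_apply,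
    bernsteinOp_bernsteinOp m n f _ hN, bernsteinOp_bernsteinOp _ _ f _ hN, sub_add_cancel,
    add_sub_cancel_right, normalOrdered_comm _ _ (n - 1), normalOrdered_comm _ _ n, neg_sub]

theorem bernsteinOp_mul_succ (m : ℤ) : bernsteinOp m * bernsteinOp (m + 1) = 0 := by
  have h := bernsteinOp_mul m (m + 1)
  rw [add_sub_cancel_right] at h
  -- For `n = m + 1` the exchange relation says that the product equals its own negative.
  have h2 : (2 : ℂ) • (bernsteinOp m * bernsteinOp (m + 1)) = 0 := by
    rw [two_smul]
    nth_rewrite 1 [h]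
    exact neg_add_cancel _
  exact (smul_eq_zero.1 h2).resolve_left two_ne_zero

theorem bernsteinComp_append (μ ν : List ℤ) :
    bernsteinComp (μ ++ ν) = bernsteinComp μ * bernsteinComp ν := by
  simp [bernsteinComp]

theorem bernsteinComp_cons (a : ℤ) (μ : List ℤ) :
    bernsteinComp (a :: μ) = bernsteinOp a * bernsteinComp μ := by
  simp [bernsteinComp]

theorem mul_prod_map_add_one {S : Type*} [Ring S] {B : ℤ → S}
    (hB : ∀ m n, B m * B n = -(B (n - 1) * B (m + 1))) (Q : List ℤ) (a : ℤ) :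
    B a * ((Q.map (· + 1)).map B).prod =
      (-1) ^ Q.length * ((Q.map B).prod * B (a + Q.length)) := by
  induction Q generalizing a with
  | nil => simp
  | cons q Q ih =>
    rw [List.map_cons, List.map_cons, List.map_cons, List.prod_cons, List.prod_cons, ← mul_assoc,
      hB, add_sub_cancel_right, neg_mul, mul_assoc, ih, List.length_cons, pow_succ, ← mul_assoc,
      ((Commute.neg_one_right (B q)).pow_right Q.length).eq, Nat.cast_succ,
      show a + 1 + (Q.length : ℤ) = a + (Q.length + 1) by ring]
    simp only [mul_neg, neg_mul, mul_one, mul_assoc]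

/-- Moving a row past the rows below it. -/
theorem bernsteinOp_mul_bernsteinComp_map (Q : List ℤ) (a : ℤ) :
    bernsteinOp a * bernsteinComp (Q.map (· + 1)) =
      (-1) ^ Q.length * (bernsteinComp Q * bernsteinOp (a + Q.length)) :=
  mul_prod_map_add_one bernsteinOp_mul Q a

/-! ### Doubly infinite words -/

theorem SameWord.refl (v : ℤ → Letter) : SameWord v v :=
  ⟨0, fun n => by rw [add_zero]⟩

theorem SameWord.symm {v w : ℤ → Letter} (h : SameWord v w) : SameWord w v := by
  obtain ⟨s, hs⟩ := h
  exact ⟨-s, fun n => by rw [← hs, neg_add_cancel_right]⟩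

theorem SameWord.trans {u v w : ℤ → Letter} (h : SameWord u v) (h' : SameWord v w) :
    SameWord u w := by
  obtain ⟨s, hs⟩ := h
  obtain ⟨t, ht⟩ := h'
  exact ⟨s + t, fun n => by rw [← add_assoc, ht, hs]⟩

/-- The sequence `a, f 0, f 1, …`. -/
def seqCons (a : Letter) (f : ℕ → Letter) : ℕ → Letter
  | 0 => a
  | n + 1 => f n

theorem seqCons_eta (f : ℕ → Letter) : seqCons (f 0) (fun n => f (n + 1)) = f := by
  funext n
  cases n <;> rfl

/-- The word `β`, running to the left, continued by the finite word `p`. -/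
def appendLeft (β : ℕ → Letter) (p : List Letter) : ℕ → Letter :=
  p.foldl (fun f a => seqCons a f) β

/-- The finite word `q` followed by `γ`. -/
def appendRight (q : List Letter) (γ : ℕ → Letter) : ℕ → Letter :=
  q.foldr seqCons γ

theorem biWord_natCast (β γ : ℕ → Letter) (w : List Letter) (n : ℕ) :
    biWord β w γ n = if h : n < w.length then w[n] else γ (n - w.length) :=
  rfl

theorem biWord_negSucc (β γ : ℕ → Letter) (w : List Letter) (n : ℕ) :
    biWord β w γ (-(n + 1 : ℤ)) = β n := by
  rw [← Int.negSucc_eq]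
  rfl

theorem biWord_cons (β γ : ℕ → Letter) (a : Letter) (w : List Letter) (n : ℤ) :
    biWord β (a :: w) γ (n + 1) = biWord (seqCons a β) w γ n := by
  obtain ⟨n, rfl | rfl⟩ : ∃ m : ℕ, n = m ∨ n = -(m + 1 : ℤ) := by
    rcases lt_or_ge n 0 with h | h
    · exact ⟨(-n - 1).toNat, by omega⟩
    · exact ⟨n.toNat, by omega⟩
  · rw [← Nat.cast_succ, biWord_natCast, biWord_natCast]
    simp
  · rw [biWord_negSucc]
    cases n with
    | zero => rfl
    | succ n =>
      rw [show -(((n + 1 : ℕ) : ℤ) + 1) + 1 = -(n + 1 : ℤ) by push_cast; ring, biWord_negSucc]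
      rfl

theorem biWord_append_singleton (β γ : ℕ → Letter) (a : Letter) (w : List Letter) :
    biWord β (w ++ [a]) γ = biWord β w (seqCons a γ) := by
  funext n
  obtain ⟨n, rfl | rfl⟩ : ∃ m : ℕ, n = m ∨ n = -(m + 1 : ℤ) := by
    rcases lt_or_ge n 0 with h | h
    · exact ⟨(-n - 1).toNat, by omega⟩
    · exact ⟨n.toNat, by omega⟩
  · rw [biWord_natCast, biWord_natCast]
    rcases lt_trichotomy n w.length with h | h | h
    · rw [dif_pos h, dif_pos (by simp; omega), List.getElem_append_left h]
    · subst h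
      simp [seqCons]
    · rw [dif_neg (by simp only [List.length_append, List.length_singleton]; omega),
        dif_neg (by omega)]
      obtain ⟨t, rfl⟩ := Nat.exists_eq_add_of_lt h
      rw [show w.length + t + 1 - (w ++ [a]).length = t by simp,
        show w.length + t + 1 - w.length = t + 1 by omega]
      rfl
  · rw [biWord_negSucc, biWord_negSucc]

theorem biWord_append_left (β γ : ℕ → Letter) (p w : List Letter) (n : ℤ) :
    biWord β (p ++ w) γ (n + p.length) = biWord (appendLeft β p) w γ n := by
  induction p generalizing β with
  | nil => simp [appendLeft]
  | cons a p ih =>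
    rw [List.length_cons, Nat.cast_succ, ← add_assoc, List.cons_append, biWord_cons, ih]
    rfl

theorem biWord_append_right (β γ : ℕ → Letter) (w q : List Letter) :
    biWord β (w ++ q) γ = biWord β w (appendRight q γ) := by
  induction q generalizing w with
  | nil => simp [appendRight]
  | cons a q ih =>
    rw [List.append_cons, ih, biWord_append_singleton]
    rfl

/-! ### Finite words between `⋯UUU` and `RRR⋯` -/

/-- The doubly infinite word `⋯ U U U w R R R ⋯`. -/
def finWord (w : List Letter) : ℤ → Letter :=
  biWord (fun _ => Letter.U) w (fun _ => Letter.R)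

theorem finWord_append (p w q : List Letter) (n : ℤ) :
    finWord (p ++ w ++ q) (n + p.length) =
      biWord (appendLeft (fun _ => Letter.U) p) w (appendRight q fun _ => Letter.R) n := by
  rw [finWord, List.append_assoc, biWord_append_left, biWord_append_right]

theorem appendRight_replicate (a : Letter) (n : ℕ) :
    appendRight (List.replicate n a) (fun _ => a) = fun _ => a := by
  induction n with
  | zero => rfl
  | succ n ih =>
    rw [List.replicate_succ, appendRight, List.foldr_cons, ← appendRight, ih]
    exact seqCons_eta fun _ => a

theorem appendLeft_replicate (a : Letter) (n : ℕ) :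
    appendLeft (fun _ => a) (List.replicate n a) = fun _ => a := by
  induction n with
  | zero => rfl
  | succ n ih =>
    rw [List.replicate_succ, appendLeft, List.foldl_cons, seqCons_eta fun _ => a]
    exact ih

theorem finWord_append_replicate_R (w : List Letter) (n : ℕ) :
    finWord (w ++ List.replicate n Letter.R) = finWord w := by
  rw [finWord, biWord_append_right, appendRight_replicate, finWord]

theorem finWord_replicate_U_append (w : List Letter) (a : ℕ) (n : ℤ) :
    finWord (List.replicate a Letter.U ++ w) (n + a) = finWord w n := by
  have := biWord_append_left (fun _ => Letter.U) (fun _ => Letter.R) (List.replicate a Letter.U) w n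
  rwa [List.length_replicate, appendLeft_replicate] at this

/-- The finite word `f (n - 1), …, f 1, f 0`. -/
def revTake (f : ℕ → Letter) : ℕ → List Letter
  | 0 => []
  | n + 1 => f n :: revTake f n

theorem length_revTake (f : ℕ → Letter) (n : ℕ) : (revTake f n).length = n := by
  induction n with
  | zero => rfl
  | succ n ih => rw [revTake, List.length_cons, ih]

theorem revTake_add (f : ℕ → Letter) (k n : ℕ) :
    revTake f (n + k) = revTake (fun i => f (i + k)) n ++ revTake f k := by
  induction n with
  | zero => rw [zero_add]; rfl
  | succ n ih => rw [add_right_comm, revTake, ih]; rfl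

theorem revTake_congr {f g : ℕ → Letter} {n : ℕ} (h : ∀ i < n, f i = g i) :
    revTake f n = revTake g n := by
  induction n with
  | zero => rfl
  | succ n ih => rw [revTake, revTake, h n (by omega), ih fun i hi => h i (by omega)]

theorem appendLeft_revTake {f : ℕ → Letter} {a : Letter} {n : ℕ} (h : ∀ i, n ≤ i → f i = a) :
    appendLeft (fun _ => a) (revTake f n) = f := by
  induction n generalizing f with
  | zero => funext i; exact (h i (Nat.zero_le i)).symm
  | succ n ih =>
    rw [revTake_add f 1 n, appendLeft, List.foldl_append]
    exact (congrArg (seqCons (f 0)) (ih fun i hi => h (i + 1) (by omega))).trans (seqCons_eta f)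

/-- The finite word `f 0, f 1, …, f (n - 1)`. -/
def takeWord (f : ℕ → Letter) (n : ℕ) : List Letter :=
  (List.range n).map f

theorem appendRight_takeWord {f : ℕ → Letter} {a : Letter} {n : ℕ} (h : ∀ i, n ≤ i → f i = a) :
    appendRight (takeWord f n) (fun _ => a) = f := by
  induction n generalizing f with
  | zero => funext i; exact (h i (Nat.zero_le i)).symm
  | succ n ih =>
    rw [takeWord, List.range_succ_eq_map, List.map_cons, List.map_map, appendRight,
      List.foldr_cons]
    exact (congrArg (seqCons (f 0)) (ih fun i hi => h (i + 1) (by omega))).trans (seqCons_eta f)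

theorem eq_append_replicate_of_finWord_eq {w w' : List Letter} (h : finWord w = finWord w')
    (hl : w.length ≤ w'.length) :
    w' = w ++ List.replicate (w'.length - w.length) Letter.R := by
  refine List.ext_getElem (by simp; omega) fun n h1 h2 => ?_
  have hn := congrFun h (n : ℤ)
  rw [finWord, finWord, biWord_natCast, biWord_natCast, dif_pos h1] at hn
  rw [← hn]
  split_ifs with h3
  · rw [List.getElem_append_left h3]
  · rw [List.getElem_append_right (by omega), List.getElem_replicate]

/-- A doubly infinite word equal to `finWord w` up to translation, in finite terms. -/
theorem exists_window {w x : List Letter} {β γ : ℕ → Letter} {s : ℕ}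
    (h : ∀ n : ℤ, finWord w (n + s) = biWord β x γ n) :
    ∃ (C : List Letter) (t : ℕ), (∀ i, s ≤ i → β i = Letter.U) ∧
      γ = appendRight C (fun _ => Letter.R) ∧
      w ++ List.replicate t Letter.R = revTake β s ++ x ++ C := by
  -- The finite word `w` begins `s` places to the right of where `x` does when positions are aligned
  -- by `s`-translation from the left end: letters of `β` beyond the first `s` fall on the left tail
  -- of `finWord w`.
  have hβ : ∀ i, s ≤ i → β i = Letter.U := by
    intro i hi
    rw [← biWord_negSucc β γ x i, ← h,
      show -(i + 1 : ℤ) + s = -((i - s : ℕ) + 1 : ℤ) by omega]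
    exact biWord_negSucc _ _ _ _
  have hγ : ∀ i, w.length ≤ i → γ i = Letter.R := by
    intro i hi
    have h1 := h ((x.length + i : ℕ) : ℤ)
    rw [← Nat.cast_add, finWord, biWord_natCast, biWord_natCast, dif_neg (by omega),
      dif_neg (by omega), Nat.add_sub_cancel_left] at h1
    exact h1.symm
  refine ⟨takeWord γ w.length,
    (revTake β s ++ x ++ takeWord γ w.length).length - w.length, hβ,
    (appendRight_takeWord hγ).symm, (eq_append_replicate_of_finWord_eq ?_ ?_).symm⟩
  · funext n
    have h1 := finWord_append (revTake β s) x (takeWord γ w.length) (n - s)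
    rw [length_revTake, sub_add_cancel, appendLeft_revTake hβ, appendRight_takeWord hγ, ← h,
      sub_add_cancel] at h1
    exact h1.symm
  · simp only [takeWord, List.length_append, List.length_map, List.length_range]
    omega

theorem SameWord.exists_window {w x : List Letter} {β γ : ℕ → Letter}
    (h : SameWord (biWord β x γ) (finWord w)) :
    ∃ (A C : List Letter) (a t : ℕ), β = appendLeft (fun _ => Letter.U) A ∧
      γ = appendRight C (fun _ => Letter.R) ∧
      List.replicate a Letter.U ++ w ++ List.replicate t Letter.R = A ++ x ++ C := by
  obtain ⟨s, hs⟩ := h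
  -- A negative shift is made nonnegative by counting `-s` further letters `U` of the left tail as
  -- part of the finite word.
  have h1 : ∀ n : ℤ, finWord (List.replicate (-s).toNat Letter.U ++ w) (n + s.toNat) =
      biWord β x γ n := by
    intro n
    rw [show n + (s.toNat : ℤ) = n + s + (-s).toNat by omega, finWord_replicate_U_append, hs]
  obtain ⟨C, t, hβ, hγ, he⟩ := _root_.exists_window h1
  exact ⟨_, C, _, t, (appendLeft_revTake hβ).symm, hγ, he⟩

/-! ### The rows of a finite word -/

/-- Reading one letter: the state consists of the abscissas of the steps up so far, the last one
first, and the present abscissa. -/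
def walk : List ℤ × ℤ → Letter → List ℤ × ℤ
  | (acc, x), Letter.R => (acc, x + 1)
  | (acc, x), Letter.L => (acc, x - 1)
  | (acc, x), Letter.U => (x :: acc, x)

/-- The abscissas of the steps up of a finite word that starts at abscissa `0`, the last one
first. -/
def rows (w : List Letter) : List ℤ :=
  (w.foldl walk ([], 0)).1

/-- The abscissa of the end point of a finite word that starts at abscissa `0`. -/
def disp (w : List Letter) : ℤ :=
  (w.foldl walk ([], 0)).2

/-- Reading commutes with horizontal translation, so a word acts on any state through `rows` and
`disp` alone. This yields the concatenation rules on which all later computations rest. -/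
theorem foldl_walk (acc : List ℤ) (x : ℤ) (w : List Letter) :
    w.foldl walk (acc, x) = ((rows w).map (· + x) ++ acc, x + disp w) := by
  induction w using List.reverseRecOn with
  | nil => simp [rows, disp]
  | append_singleton w a ih =>
    rw [rows, disp, List.foldl_append, List.foldl_append, ih]
    have h : w.foldl walk ([], 0) = (rows w, disp w) := rfl
    rw [h]
    cases a
    · simp [walk, add_assoc]
    · simp [walk, add_sub_assoc]
    · simp [walk, add_comm]

theorem rows_append (v w : List Letter) :
    rows (v ++ w) = (rows w).map (· + disp v) ++ rows v := by
  rw [rows, List.foldl_append]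
  exact congrArg Prod.fst (foldl_walk (rows v) (disp v) w)

theorem disp_append (v w : List Letter) : disp (v ++ w) = disp v + disp w := by
  rw [disp, List.foldl_append]
  exact congrArg Prod.snd (foldl_walk (rows v) (disp v) w)

theorem rows_nil : rows [] = [] := rfl
theorem disp_nil : disp [] = 0 := rfl
theorem rows_R : rows [Letter.R] = [] := rfl
theorem disp_R : disp [Letter.R] = 1 := rfl
theorem rows_L : rows [Letter.L] = [] := rfl
theorem disp_L : disp [Letter.L] = -1 := rfl
theorem rows_U : rows [Letter.U] = [0] := rfl
theorem disp_U : disp [Letter.U] = 0 := rfl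

theorem rows_replicate_R (n : ℕ) : rows (List.replicate n Letter.R) = [] := by
  induction n with
  | zero => rfl
  | succ n ih => rw [List.replicate_succ', rows_append, ih, rows_R]; rfl

theorem disp_replicate_R (n : ℕ) : disp (List.replicate n Letter.R) = n := by
  induction n with
  | zero => rfl
  | succ n ih => rw [List.replicate_succ', disp_append, ih, disp_R, Nat.cast_succ]

theorem rows_replicate_L (n : ℕ) : rows (List.replicate n Letter.L) = [] := by
  induction n with
  | zero => rfl
  | succ n ih => rw [List.replicate_succ', rows_append, ih, rows_L]; rfl

theorem disp_replicate_L (n : ℕ) : disp (List.replicate n Letter.L) = -n := by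
  induction n with
  | zero => rfl
  | succ n ih => rw [List.replicate_succ', disp_append, ih, disp_L]; push_cast; ring

theorem disp_replicate_U (n : ℕ) : disp (List.replicate n Letter.U) = 0 := by
  induction n with
  | zero => rfl
  | succ n ih => rw [List.replicate_succ', disp_append, ih, disp_U, add_zero]

theorem rows_replicate_U (n : ℕ) : rows (List.replicate n Letter.U) = List.replicate n 0 := by
  induction n with
  | zero => rfl
  | succ n ih =>
    rw [List.replicate_succ', rows_append, ih, rows_U, disp_replicate_U, List.replicate_succ]
    rfl

/-- Initial steps up occur at abscissa `0` and final right steps create no row, so enlarging the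
finite window only appends zeros. -/
theorem rows_window (a t : ℕ) (w : List Letter) :
    rows (List.replicate a Letter.U ++ w ++ List.replicate t Letter.R) =
      rows w ++ List.replicate a 0 := by
  rw [rows_append, rows_append, rows_replicate_R, rows_replicate_U, disp_replicate_U]
  simp

theorem rows_hSteps (a b : ℤ) : rows (hSteps a b) = [] := by
  rw [hSteps, rows_append, rows_replicate_L, rows_replicate_R]
  rfl

theorem disp_hSteps (a b : ℤ) : disp (hSteps a b) = b - a := by
  rw [hSteps, disp_append, disp_replicate_L, disp_replicate_R]
  omega

theorem disp_rowWord (μ : List ℤ) : disp (rowWord μ) = μ.headD 0 := by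
  induction μ with
  | nil => rfl
  | cons a μ ih =>
    rw [rowWord, disp_append, disp_append, ih, disp_hSteps, disp_U]
    simp

theorem rows_rowWord (μ : List ℤ) : rows (rowWord μ) = μ := by
  induction μ with
  | nil => rfl
  | cons a μ ih =>
    rw [rowWord, rows_append, rows_append, disp_append, ih, disp_hSteps, disp_rowWord, rows_hSteps,
      rows_U]
    simp

/-! ### Cancellation -/

theorem ReducesTo.of_sameWord {v w : ℤ → Letter} (h : SameWord v w) : ReducesTo v w :=
  Relation.ReflTransGen.single (Or.inl h)

theorem ReducesTo.trans {u v w : ℤ → Letter} (h : ReducesTo u v) (h' : ReducesTo v w) :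
    ReducesTo u w :=
  Relation.ReflTransGen.trans h h'

theorem reducesTo_cancel (p q x : List Letter)
    (hx : x = [Letter.L, Letter.R] ∨ x = [Letter.R, Letter.L]) :
    ReducesTo (finWord (p ++ x ++ q)) (finWord (p ++ q)) := by
  refine Relation.ReflTransGen.single (Or.inr ⟨_, _, x, hx,
    SameWord.symm ⟨p.length, finWord_append p x q⟩, SameWord.symm ⟨p.length, fun n => ?_⟩⟩)
  rw [← finWord_append, List.append_nil]

/-- The horizontal steps since the last step up are all `R` or all `L`. A new `R` prolongs the run
in the first case and cancels the last `L` in the second. -/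
theorem hSteps_add_one (h x : ℤ) (w : List Letter) :
    hSteps h x ++ Letter.R :: w = hSteps h (x + 1) ++ w ∨
      ∃ t, hSteps h x ++ Letter.R :: w = t ++ [Letter.L, Letter.R] ++ w ∧
        hSteps h (x + 1) ++ w = t ++ w := by
  rcases le_or_gt h x with hx | hx
  · left
    rw [hSteps, hSteps, show (h - x).toNat = 0 by omega, show (h - (x + 1)).toNat = 0 by omega,
      show (x + 1 - h).toNat = (x - h).toNat + 1 by omega, List.replicate_succ']
    simp
  · right
    refine ⟨hSteps h (x + 1), ?_, rfl⟩
    rw [hSteps, hSteps, show (x - h).toNat = 0 by omega, show (x + 1 - h).toNat = 0 by omega,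
      show (h - x).toNat = (h - (x + 1)).toNat + 1 by omega, List.replicate_succ']
    simp

theorem hSteps_sub_one (h x : ℤ) (w : List Letter) :
    hSteps h x ++ Letter.L :: w = hSteps h (x - 1) ++ w ∨
      ∃ t, hSteps h x ++ Letter.L :: w = t ++ [Letter.R, Letter.L] ++ w ∧
        hSteps h (x - 1) ++ w = t ++ w := by
  rcases le_or_gt x h with hx | hx
  · left
    rw [hSteps, hSteps, show (x - h).toNat = 0 by omega, show (x - 1 - h).toNat = 0 by omega,
      show (h - (x - 1)).toNat = (h - x).toNat + 1 by omega, List.replicate_succ']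
    simp
  · right
    refine ⟨hSteps h (x - 1), ?_, rfl⟩
    rw [hSteps, hSteps, show (h - x).toNat = 0 by omega, show (h - (x - 1)).toNat = 0 by omega,
      show (x - h).toNat = (x - 1 - h).toNat + 1 by omega, List.replicate_succ']
    simp

/-- Loop invariant of the reduction: the part already read has been brought to the form `rowWord
acc` followed by reduced horizontal steps to `x`, and each further letter costs at most one
cancellation. -/
theorem reducesTo_foldl_walk (w : List Letter) (acc : List ℤ) (x : ℤ) :
    ReducesTo (finWord (rowWord acc ++ (hSteps (acc.headD 0) x ++ w)))
      (finWord (rowWord (w.foldl walk (acc, x)).1 ++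
        hSteps ((w.foldl walk (acc, x)).1.headD 0) (w.foldl walk (acc, x)).2)) := by
  induction w generalizing acc x with
  | nil =>
    rw [List.append_nil]
    exact Relation.ReflTransGen.refl
  | cons a w ih =>
    rw [List.foldl_cons]
    cases a
    · refine ReducesTo.trans ?_ (ih acc (x + 1))
      rcases hSteps_add_one (acc.headD 0) x w with h | ⟨t, h1, h2⟩
      · rw [h]
        exact Relation.ReflTransGen.refl
      · rw [h1, h2]
        simpa using reducesTo_cancel (rowWord acc ++ t) w _ (Or.inl rfl)
    · refine ReducesTo.trans ?_ (ih acc (x - 1))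
      rcases hSteps_sub_one (acc.headD 0) x w with h | ⟨t, h1, h2⟩
      · rw [h]
        exact Relation.ReflTransGen.refl
      · rw [h1, h2]
        simpa using reducesTo_cancel (rowWord acc ++ t) w _ (Or.inr rfl)
    · have e : rowWord acc ++ (hSteps (acc.headD 0) x ++ Letter.U :: w) =
          rowWord (x :: acc) ++ (hSteps ((x :: acc).headD 0) x ++ w) := by
        simp [rowWord, hSteps]
      rw [e]
      exact ih (x :: acc) x

/-- The word `⋯ U U U w R R R ⋯` gives the code of `rows w`. -/
theorem reducesTo_code_rows (w : List Letter) : ReducesTo (finWord w) (code (rows w)) := by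
  -- Enough letters `R` are borrowed from the right tail that the horizontal steps left after the
  -- last `U` are all `R`; they are then absorbed into that tail.
  obtain ⟨t, ht⟩ : ∃ t : ℕ, (rows w).headD 0 ≤ disp w + t :=
    ⟨((rows w).headD 0 - disp w).toNat, by omega⟩
  have h := reducesTo_foldl_walk (w ++ List.replicate t Letter.R) [] 0
  have e1 : ((w ++ List.replicate t Letter.R).foldl walk ([], 0)).1 = rows w := by
    change rows _ = _
    rw [rows_append, rows_replicate_R]
    rfl
  have e2 : ((w ++ List.replicate t Letter.R).foldl walk ([], 0)).2 = disp w + t := by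
    change disp _ = _
    rw [disp_append, disp_replicate_R]
  have e4 : hSteps ((rows w).headD 0) (disp w + t) =
      List.replicate (disp w + t - (rows w).headD 0).toNat Letter.R := by
    rw [hSteps, show ((rows w).headD 0 - (disp w + t)).toNat = 0 by omega, List.replicate_zero,
      List.append_nil]
  rw [e1, e2, e4, finWord_append_replicate_R] at h
  have e3 : rowWord [] ++ (hSteps (([] : List ℤ).headD 0) 0 ++ (w ++ List.replicate t Letter.R)) =
      w ++ List.replicate t Letter.R := by
    simp [rowWord, hSteps]
  rwa [e3, finWord_append_replicate_R] at h

/-! ### An invariant of cancellation, and uniqueness of `ν` -/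

/-- `f r` is the abscissa of the `r`-th last step up, for a word which is `U` far on the left and
`R` far on the right, the abscissas being `0` far on the left. -/
def HasProfile (v : ℤ → Letter) (f : ℕ → ℤ) : Prop :=
  ∃ w, SameWord v (finWord w) ∧ ∀ r, (rows w).getD r 0 = f r

theorem getD_append_replicate_zero (l : List ℤ) (a r : ℕ) :
    (l ++ List.replicate a 0).getD r 0 = l.getD r 0 := by
  rcases lt_or_ge r l.length with h | h
  · rw [List.getD_append _ _ _ _ h]
  · rw [List.getD_append_right _ _ _ _ h, List.getD_eq_default _ _ h]
    rcases lt_or_ge (r - l.length) a with h' | h'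
    · exact List.getD_replicate _ h'
    · rw [List.getD_eq_default _ _ (by simpa using h')]

theorem HasProfile.sameWord {v v' : ℤ → Letter} {f : ℕ → ℤ} (h : HasProfile v f)
    (hv : SameWord v v') : HasProfile v' f := by
  obtain ⟨w, hw, hf⟩ := h
  exact ⟨w, hv.symm.trans hw, hf⟩

/-- The deleted pair contains no step up and has total displacement `0`, so no abscissa changes.
Padding by zeros hides the choice of the finite window. -/
theorem HasProfile.cancelStep {v v' : ℤ → Letter} {f : ℕ → ℤ} (h : HasProfile v f)
    (hv : CancelStep v v') : HasProfile v' f := by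
  obtain ⟨w, hw, hf⟩ := h
  obtain ⟨β, γ, x, hx, h1, h2⟩ := hv
  obtain ⟨A, C, a, t, rfl, rfl, he⟩ := (h1.symm.trans hw).exists_window
  refine ⟨A ++ [] ++ C, h2.trans ⟨A.length, finWord_append A [] C⟩, fun r => ?_⟩
  have hx0 : rows x = [] ∧ disp x = 0 := by
    rcases hx with rfl | rfl <;> exact ⟨rfl, rfl⟩
  have h3 := congrArg rows he
  rw [rows_window, rows_append, rows_append, disp_append, hx0.1, hx0.2] at h3
  rw [← hf r, ← getD_append_replicate_zero (rows w) a, h3, rows_append, rows_append, disp_append,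
    rows_nil, disp_nil]

theorem HasProfile.reducesTo {v v' : ℤ → Letter} {f : ℕ → ℤ} (h : HasProfile v f)
    (hv : ReducesTo v v') : HasProfile v' f := by
  induction hv with
  | refl => exact h
  | tail _ hs ih => exact hs.elim ih.sameWord ih.cancelStep

/-- Two finite words with the same doubly infinite word differ only by `U`'s on the left and `R`'s
on the right, and these do not affect the padded rows. -/
theorem HasProfile.code_eq {ν : List ℤ} {f : ℕ → ℤ} (h : HasProfile (code ν) f) (r : ℕ) :
    ν.getD r 0 = f r := by
  obtain ⟨w, hw, hf⟩ := h
  obtain ⟨A, C, a, t, hA, hC, he⟩ := SameWord.exists_window (x := rowWord ν) hw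
  -- A finite word that extends the left tail without changing it consists of `U`'s alone; likewise
  -- below for `R`'s on the right.
  have hA' : ∀ b, appendLeft (fun _ => Letter.U) A = (fun _ => Letter.U) →
      b ∈ A → b = Letter.U := by
    intro b h hb
    obtain ⟨p, q, rfl⟩ := List.append_of_mem hb
    have h1 := biWord_append_left (fun _ => Letter.U) (fun _ => Letter.R) (p ++ b :: q) []
      (-(q.length + 1 : ℤ))
    rw [h, List.append_nil, biWord_negSucc,
      show -(q.length + 1 : ℤ) + ((p ++ b :: q).length : ℕ) = (p.length : ℕ) by
        simp only [List.length_append, List.length_cons]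
        push_cast
        ring,
      biWord_natCast] at h1
    simpa using h1
  have hC' : ∀ b, appendRight C (fun _ => Letter.R) = (fun _ => Letter.R) →
      b ∈ C → b = Letter.R := by
    intro b h hb
    obtain ⟨p, q, rfl⟩ := List.append_of_mem hb
    have h1 := congrFun (biWord_append_right (fun _ => Letter.U) (fun _ => Letter.R) []
      (p ++ b :: q)) (p.length : ℤ)
    rw [h, List.nil_append, biWord_natCast, biWord_natCast] at h1
    simpa using h1
  rw [List.eq_replicate_of_mem fun b hb => hA' b hA.symm hb,
    List.eq_replicate_of_mem fun b hb => hC' b hC.symm hb] at he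
  have h3 := congrArg rows he
  rw [rows_window, rows_window, rows_rowWord] at h3
  rw [← hf r, ← getD_append_replicate_zero (rows w) a, h3, getD_append_replicate_zero]

/-- A finite word determines the composition of given length whose code it gives. -/
theorem eq_rows_of_reducesTo {w : List Letter} {ν : List ℤ} (h : ReducesTo (finWord w) (code ν))
    (hl : ν.length = (rows w).length) : ν = rows w := by
  have hp : HasProfile (finWord w) fun r => (rows w).getD r 0 := ⟨w, SameWord.refl _, fun _ => rfl⟩
  refine List.ext_getElem hl fun r h1 h2 => ?_
  have := (hp.reducesTo h).code_eq r
  rwa [List.getD_eq_getElem _ _ h1, List.getD_eq_getElem _ _ h2] at this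

/-! ### Counting letters -/

theorem length_rows (w : List Letter) : (rows w).length = w.count Letter.U := by
  induction w using List.reverseRecOn with
  | nil => rfl
  | append_singleton w a ih =>
    rw [rows_append, List.length_append, List.length_map, ih, List.count_append, add_comm]
    cases a <;> rfl

theorem count_revTake (f : ℕ → Letter) (n : ℕ) :
    (revTake f n).count Letter.U =
      ((Finset.range n).filter fun i => f i = Letter.U).card := by
  induction n with
  | zero => rfl
  | succ n ih =>
    rw [revTake, Finset.range_add_one, Finset.filter_insert, List.count_cons, ih]
    by_cases h : f n = Letter.U <;> simp [h]

theorem mem_revTake {f : ℕ → Letter} {n : ℕ} {a : Letter} (h : a ∈ revTake f n) :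
    ∃ i, a = f i := by
  induction n with
  | zero => simp [revTake] at h
  | succ n ih =>
    rcases List.mem_cons.1 h with h | h
    · exact ⟨n, h⟩
    · exact ih h

/-- A word without `L`. -/
theorem disp_of_forall_ne_L {w : List Letter} (hw : ∀ a ∈ w, a = Letter.R ∨ a = Letter.U) :
    disp w = w.length - (rows w).length ∧ 0 ≤ disp w ∧ ∀ a ∈ rows w, 0 ≤ a := by
  induction w using List.reverseRecOn with
  | nil => simp [disp_nil, rows_nil]
  | append_singleton w a ih =>
    obtain ⟨h1, h2, h3⟩ := ih fun b hb => hw b (by simp [hb])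
    rcases hw a (by simp) with rfl | rfl
    · rw [disp_append, disp_R, rows_append, rows_R, List.length_append]
      refine ⟨?_, by omega, by simpa using h3⟩
      simp [h1]
      ring
    · rw [disp_append, disp_U, rows_append, rows_U, List.length_append]
      refine ⟨?_, by omega, ?_⟩
      · simp [h1]
      · simpa using ⟨h2, h3⟩

/-! ### Straightening -/

/-- The composition before straightening, top row first: the entry standing alone is the row of the
`U` after `L^k`, and the rows of `B` are those it has to pass. -/
theorem rows_leg {A B C : List Letter} {b : Letter} (k : ℕ) :
    rows (A ++ b :: B ++ (List.replicate k Letter.L ++ [Letter.U]) ++ C) =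
      (rows C).map (· + (disp A + disp [b] + disp B - k)) ++
        (disp A + disp [b] + disp B - k) ::
          ((rows B).map (· + (disp A + disp [b])) ++
            ((rows [b]).map (· + disp A) ++ rows A)) := by
  rw [List.append_cons A b B]
  simp only [rows_append, disp_append, rows_replicate_L, disp_replicate_L, rows_U, disp_U]
  simp [sub_eq_add_neg, add_assoc]
  ring

/-- The composition after straightening: the moved row now stands below the rows of `B` and ends
where `A` ends. -/
theorem rows_straightened {A B C : List Letter} (k : ℕ) :
    rows (A ++ Letter.U :: B ++ List.replicate k Letter.L ++ C) =
      (rows C).map (· + (disp A + disp B - k)) ++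
          ((rows B).map (· + disp A) ++ disp A :: rows A) := by
  rw [List.append_cons A Letter.U B]
  simp only [rows_append, disp_append, rows_replicate_L, disp_replicate_L, rows_U, disp_U]
  simp [sub_eq_add_neg, add_assoc]

end

/-- `μ` is a composition of `m` whose code is `… β₃ β₂ β₁ L^k U γ₁ γ₂ …`, the letter `β_i` being at
position `s - i` of the code (so that `β_k` lies on the negative `y`-axis exactly if `s < k`). -/
theorem theorem4p2 (m : ℤ) (μ : List ℤ) (hμ : μ.sum = m)
    (β γ : ℕ → Letter) (k : ℕ) (hk : 1 ≤ k) (s : ℤ)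
    (hα : ∀ n : ℤ, code μ (n + s) = biWord β (List.replicate k Letter.L ++ [Letter.U]) γ n)
    (hβ : ∀ i, β i = Letter.R ∨ β i = Letter.U) (hβ₁ : β 0 = Letter.U) :
    (β (k - 1) = Letter.U → ((∀ a ∈ μ, 0 ≤ a) ∨ (k : ℤ) ≤ s) → bernsteinComp μ = 0) ∧
    (β (k - 1) = Letter.R →
      (∃! ν : List ℤ, ν.length = μ.length ∧
        ReducesTo (biWord (Function.update β (k - 1) Letter.U)
          (List.replicate (k - 1) Letter.L) γ) (code ν)) ∧
      ∀ ν : List ℤ, ν.length = μ.length →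
        ReducesTo (biWord (Function.update β (k - 1) Letter.U)
          (List.replicate (k - 1) Letter.L) γ) (code ν) →
        ν.sum = m ∧ ((∀ a ∈ μ, 0 ≤ a) → ∀ a ∈ ν, 0 ≤ a) ∧
        bernsteinComp μ =
          (-1) ^ ((Finset.range (k - 1)).filter fun i => β i = Letter.U).card *
            bernsteinComp ν) := by
  -- Otherwise the first `L` would lie on the negative `y`-axis, where all letters are `U`.
  have hs : 0 ≤ s := by
    by_contra hs
    have h0 := hα 0
    rw [zero_add, show s = -(((-s - 1).toNat : ℕ) + 1 : ℤ) by omega, code, biWord_negSucc,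
      ← Nat.cast_zero, biWord_natCast, dif_pos (by simp),
      List.getElem_append_left (by simp; omega), List.getElem_replicate] at h0
    exact Letter.noConfusion h0
  lift s to ℕ using hs
  -- From here on `k` is one less than the number of `L`'s, so that `β k` is the decisive letter and
  -- `B` has length `k`.
  obtain ⟨k, rfl⟩ : ∃ l, k = l + 1 := ⟨k - 1, by omega⟩
  rw [Nat.add_sub_cancel]
  obtain ⟨C, t, hU, hC, he⟩ := exists_window (w := rowWord μ) hα
  have hμr : μ = rows (revTake β s ++ (List.replicate (k + 1) Letter.L ++ [Letter.U]) ++ C) := by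
    have := rows_window 0 t (rowWord μ)
    rw [List.replicate_zero, List.nil_append, he, rows_rowWord, List.replicate_zero,
      List.append_nil] at this
    exact this.symm
  have hRU : ∀ (f : ℕ → Letter) (n : ℕ), (∀ i, f i = Letter.R ∨ f i = Letter.U) →
      disp (revTake f n) = n - (rows (revTake f n)).length ∧ 0 ≤ disp (revTake f n) ∧
        ∀ a ∈ rows (revTake f n), 0 ≤ a := by
    intro f n hf
    have := disp_of_forall_ne_L (w := revTake f n) fun a ha => by
      obtain ⟨i, rfl⟩ := mem_revTake ha
      exact hf i
    rwa [length_revTake] at this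
  have hsplit : k + 1 ≤ s →
      revTake β s = revTake (fun i => β (i + (k + 1))) (s - (k + 1)) ++ β k :: revTake β k := by
    intro h
    conv_lhs => rw [← Nat.sub_add_cancel h, revTake_add]
    rfl
  have hB := hRU β k hβ
  have hA := hRU (fun i => β (i + (k + 1))) (s - (k + 1)) fun i => hβ _
  set A := revTake (fun i => β (i + (k + 1))) (s - (k + 1))
  set B := revTake β k
  refine ⟨fun hk1 hcond => ?_, fun hk1 => ?_⟩
  · by_cases hks : k + 1 ≤ s
    · rw [hμr, hsplit hks, hk1, rows_leg, bernsteinComp_append, bernsteinComp_cons,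
        bernsteinComp_append, rows_U, disp_U, add_zero]
      -- Since `disp B` is `k` minus the number of rows of `B`, the moved row arrives with length
      -- `disp A - 1`, directly before the row `disp A` of the letter `β k = U`.
      have hQ := bernsteinOp_mul_bernsteinComp_map ((rows B).map (· + (disp A - 1)))
        (disp A + disp B - (k + 1 : ℕ))
      rw [List.map_map, List.length_map,
        show ((· + 1) ∘ (· + (disp A - 1)) : ℤ → ℤ) = (· + disp A) by funext a; simp; ring,
        hB.1, show disp A + ((k : ℤ) - (rows B).length) - (k + 1 : ℕ) + (rows B).length =
          disp A - 1 by push_cast; ring] at hQ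
      have h0 := bernsteinOp_mul_succ (disp A - 1)
      rw [sub_add_cancel] at h0
      rw [← mul_assoc (bernsteinOp _), hB.1, hQ]
      simp only [List.map_cons, List.map_nil, List.cons_append, List.nil_append, zero_add,
        bernsteinComp_cons]
      rw [mul_assoc, mul_assoc, ← mul_assoc (bernsteinOp _) (bernsteinOp _), h0]
      simp
    · exfalso
      -- If `β k` lies on the negative `y`-axis, at most `s < k + 1` steps right precede the `k + 1`
      -- steps left, so the next row would be negative.
      have hnn := hcond.resolve_right (by exact_mod_cast hks)
      have hD := (hRU β s hβ).1
      have := hnn (disp (revTake β s) - (k + 1 : ℕ)) (by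
        rw [hμr]
        simp only [rows_append, disp_append, rows_replicate_L, disp_replicate_L, rows_U, disp_U]
        simp [sub_eq_add_neg, add_comm])
      omega
  · have hks : k + 1 ≤ s := by
      by_contra h
      rw [hU k (by omega)] at hk1
      exact Letter.noConfusion hk1
    rw [hsplit hks, hk1, rows_leg, rows_R, disp_R] at hμr
    have hupd : revTake (Function.update β k Letter.U) s = A ++ Letter.U :: B := by
      conv_lhs => rw [← Nat.sub_add_cancel hks, revTake_add, revTake, Function.update_self]
      congr 1
      · exact revTake_congr fun i _ => Function.update_of_ne (by omega) _ _
      · congr 1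
        exact revTake_congr fun i hi => Function.update_of_ne (by omega) _ _
    have hW : SameWord (biWord (Function.update β k Letter.U) (List.replicate k Letter.L) γ)
        (finWord (A ++ Letter.U :: B ++ List.replicate k Letter.L ++ C)) := by
      refine ⟨(A ++ Letter.U :: B).length, fun n => ?_⟩
      rw [finWord_append, ← hupd, ← hC, appendLeft_revTake]
      intro i hi
      rw [Function.update_of_ne (by omega)]
      exact hU i hi
    have hlen : (rows (A ++ Letter.U :: B ++ List.replicate k Letter.L ++ C)).length =
        μ.length := by
      rw [hμr, rows_straightened]
      simp
      omega
    have huniq : ∀ ν : List ℤ, ν.length = μ.length →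
        ReducesTo (biWord (Function.update β k Letter.U) (List.replicate k Letter.L) γ) (code ν) →
        ν = rows (A ++ Letter.U :: B ++ List.replicate k Letter.L ++ C) := fun ν h1 h2 =>
      eq_rows_of_reducesTo ((ReducesTo.of_sameWord hW.symm).trans h2) (h1.trans hlen.symm)
    refine ⟨⟨_, ⟨hlen, (ReducesTo.of_sameWord hW).trans (reducesTo_code_rows _)⟩,
      fun ν h => huniq ν h.1 h.2⟩, fun ν h1 h2 => ?_⟩
    rw [huniq ν h1 h2, rows_straightened, ← count_revTake, ← length_rows]
    have hd : disp A + 1 + disp B - (k + 1 : ℕ) = disp A + disp B - k := by push_cast; ring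
    rw [hd] at hμr
    -- Passing the rows of `B` raises the moved row by their number, hence to `disp A`; with `hm1`,
    -- which writes the rows of `B` in `μ` as those in `ν` plus one, this is what the sum and the
    -- sign need.
    have hu : disp A + disp B - k = disp A - (rows B).length := by rw [hB.1]; ring
    have hm1 : (rows B).map (· + (disp A + 1)) = ((rows B).map (· + disp A)).map (· + 1) := by
      rw [List.map_map]
      refine List.map_congr_left fun a _ => ?_
      simp [add_assoc]
    rw [hm1, List.map_nil, List.nil_append] at hμr
    refine ⟨?_, fun hnn a ha => ?_, ?_⟩
    · rw [← hμ, hμr]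
      have hsum : ∀ l : List ℤ, (l.map (· + 1)).sum = l.sum + l.length := by
        intro l
        induction l with
        | nil => rfl
        | cons a l ih => simp [ih]; ring
      simp only [List.sum_append, List.sum_cons, hsum, List.length_map]
      rw [hu]
      ring
    · rw [hμr] at hnn
      simp only [List.mem_append, List.mem_cons] at hnn ha
      -- Rows of `C` and `A` occur in `μ` as well; the others are abscissas reached from `0` by
      -- steps `R` and `U` only.
      rcases ha with ha | ha | rfl | ha
      · exact hnn a (Or.inl ha)
      · obtain ⟨q, hq, rfl⟩ := List.mem_map.1 ha
        have := hB.2.2 q hq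
        have := hA.2.1
        omega
      · exact hA.2.1
      · exact hnn a (Or.inr (Or.inr (Or.inr ha)))
    · rw [hμr, bernsteinComp_append, bernsteinComp_cons, bernsteinComp_append,
        bernsteinComp_append, bernsteinComp_append, bernsteinComp_cons, ← mul_assoc (bernsteinOp _),
        bernsteinOp_mul_bernsteinComp_map, List.length_map, hu, sub_add_cancel]
      rcases neg_one_pow_eq_or (Module.End ℂ SymFun) (rows B).length with h | h <;> rw [h] <;>
        simp only [one_mul, neg_mul, mul_neg, mul_assoc]
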